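/- **Theorem (Helmholtz decomposition).** Let $F:\mathbb R^3\to\mathbb R^3$ be a $C^2$ vector field whose first-order partial derivatives are bounded, and suppose that $F$ decays faster than $|x|^{-2}$ in the sense that there are $\varepsilon>0$ and $C\in\mathbb R$ with $$|F(x)|\le C\,(1+|x|)^{-(2+\varepsilon)}\qquad\text{for all }x\in\mathbb R^3 .$$ Then there is exactly one pair $(F_c,F_s)$ of $C^1$ vector fields $F_c,F_s:\mathbb R^3\to\mathbb R^3$, both tending to $0$ at infinity, such that $$F=F_c+F_s,\qquad \nabla\times F_c=0,\qquad \nabla\cdot F_s=0\qquad\text{on }\mathbb R^3 .$$ -/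

import Mathlib

/-- Three-dimensional Euclidean space. -/
abbrev R3 : Type := EuclideanSpace ℝ (Fin 3)

/-- The partial derivative `∂ Fⱼ / ∂ xᵢ` at `x` of the `j`-th component of a vector field `F`
on `ℝ³` (used for differentiable fields). -/
noncomputable def pderiv (F : R3 → R3) (i j : Fin 3) (x : R3) : ℝ :=
  (fderiv ℝ F x (EuclideanSpace.single i 1)) j

/-- The divergence `∇ ⬝ F`. -/
noncomputable def divergence (F : R3 → R3) (x : R3) : ℝ :=
  ∑ i : Fin 3, pderiv F i i x

/-- The curl `∇ × F`. -/
noncomputable def curl (F : R3 → R3) (x : R3) : R3 :=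
  !₂[pderiv F 1 2 x - pderiv F 2 1 x,
     pderiv F 2 0 x - pderiv F 0 2 x,
     pderiv F 0 1 x - pderiv F 1 0 x]

/-- A vector field on `ℝ³` tends to zero at infinity. -/
def VanishesAtInfinity (F : R3 → R3) : Prop :=
  Filter.Tendsto F (Filter.cocompact R3) (nhds 0)

/-- `(Fc, Fs)` is a decomposition of `F` into an irrotational field `Fc` and a divergence-free
field `Fs`, both continuously differentiable and vanishing at infinity. -/
structure IsHelmholtzDecomposition (F Fc Fs : R3 → R3) : Prop where
  contDiff_conservative : ContDiff ℝ 1 Fc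
  contDiff_solenoidal : ContDiff ℝ 1 Fs
  vanishes_conservative : VanishesAtInfinity Fc
  vanishes_solenoidal : VanishesAtInfinity Fs
  irrotational : ∀ x, curl Fc x = 0
  divergence_free : ∀ x, divergence Fs x = 0
  sum_eq : ∀ x, F x = Fc x + Fs x

open MeasureTheory Set Filter Topology
open scoped ContDiff

/-! Write `A_ψ f (x, t) = ∫ ψ(z) f(x - t z) dz` for `scaledAverage`. Choose `w` smooth, compactly
supported, of integral one, such that `z ↦ w(z) z` is the gradient of a test function `φ`. Then `A_w
f (x, 0) = f(x)` and `d/dt A_w f = -∑ⱼ A_{∂ⱼφ}(∂ⱼf)`, so whenever `A_w f → 0` as `t → ∞` and the sum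
is integrable in `t`, `f(x) = ∫₀^∞ ∑ⱼ A_{∂ⱼφ}(∂ⱼf)(x, t) dt`
(`IsRadialKernel.integral_sum_scaledAverage`). The second tool is integration by parts, `t A_ψ(∂ⱼf)
= A_{∂ⱼψ} f`, which trades derivatives of `f` for derivatives of the weight.

Existence: with `h = ∇·F`, put `Gᵢ = ∫₀^∞ A_{∂ᵢφ} h dt`. Formally this is the convolution of `h`
with `yᵢ / (4π|y|³)`, the gradient of the Newtonian potential, but cut into scales so that no
singular integral appears. The formula above gives `∇·G = h`, and the symmetry of `∂ᵢ∂ⱼφ` gives `∇×G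
= 0`; hence `(G, F - G)` is a decomposition. Convergence rests on `|A_ψ h| ≤ C / (1 + t²)`: bounded
derivatives of `F` handle small `t`, while for large `t` one factor `1/t` comes from integrating by
parts and another from `F ∈ L²`. The decay of `F` enters only through `F → 0` and `F ∈ L²`.

Uniqueness: for an irrotational, solenoidal `C¹` field `D → 0`, the same formula for `Dᵢ` has
integrand zero after the indices are swapped, so neither harmonicity nor Liouville's theorem is
needed. -/

/-- The average of the dilated translates `z ↦ f (x - t z)` of `f` against the weight `ψ`. -/
noncomputable def scaledAverage {E : Type*} [NormedAddCommGroup E] [NormedSpace ℝ E]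
    (ψ : R3 → ℝ) (f : R3 → E) (x : R3) (t : ℝ) : E :=
  ∫ z, ψ z • f (x - t • z)

/-- The partial derivative of a scalar function on `ℝ³`. -/
noncomputable def partialDeriv (j : Fin 3) (f : R3 → ℝ) (x : R3) : ℝ :=
  fderiv ℝ f x (EuclideanSpace.single j 1)

/-! ### Scaled averages: continuity and differentiation. -/

section Average

variable {E : Type*} [NormedAddCommGroup E] [NormedSpace ℝ E]
  {ψ : R3 → ℝ} {f : R3 → E}

theorem HasCompactSupport.partialDeriv (hc : HasCompactSupport ψ) (j : Fin 3) :
    HasCompactSupport (partialDeriv j ψ) :=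
  (hc.fderiv_apply ℝ (EuclideanSpace.single j 1))

theorem ContDiff.partialDeriv {m n : WithTop ℕ∞} {f : R3 → ℝ} (hf : ContDiff ℝ n f)
    (hmn : m + 1 ≤ n) (j : Fin 3) : ContDiff ℝ m (partialDeriv j f) :=
  (hf.fderiv_right hmn).clm_apply contDiff_const

theorem continuous_partialDeriv {f : R3 → ℝ} (hf : ContDiff ℝ 1 f) (j : Fin 3) :
    Continuous (partialDeriv j f) :=
  (hf.partialDeriv (m := 0) (by simp) j).continuous

theorem continuous_weight_smul (hψ : Continuous ψ) (hf : Continuous f) (x : R3) (t : ℝ) :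
    Continuous fun z => ψ z • f (x - t • z) := by fun_prop

theorem integrable_weight_smul (hψ : Continuous ψ) (hc : HasCompactSupport ψ)
    (hf : Continuous f) (x : R3) (t : ℝ) :
    Integrable fun z => ψ z • f (x - t • z) :=
  (continuous_weight_smul hψ hf x t).integrable_of_hasCompactSupport hc.smul_right

theorem continuous_scaledAverage (hψ : Continuous ψ) (hc : HasCompactSupport ψ)
    (hf : Continuous f) :
    Continuous fun P : R3 × ℝ => scaledAverage ψ f P.1 P.2 := by
  have h := continuous_parametric_integral_of_continuous (μ := (volume : Measure R3))
    (f := fun (P : R3 × ℝ) z => ψ z • f (P.1 - P.2 • z)) (by fun_prop) hc.isCompact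
  convert h using 2 with P
  refine (setIntegral_eq_integral_of_forall_compl_eq_zero fun z hz => ?_).symm
  simp [image_eq_zero_of_notMem_tsupport hz]

/-- Differentiation under the integral sign against a compactly supported weight. -/
theorem hasFDerivAt_integral_weight_smul {H : Type*} [NormedAddCommGroup H] [NormedSpace ℝ H]
    [ProperSpace H] {G : H → R3 → E} {G' : H → R3 → H →L[ℝ] E}
    (hψ : Continuous ψ) (hc : HasCompactSupport ψ)
    (hG : Continuous (Function.uncurry G)) (hG' : Continuous (Function.uncurry G'))
    (hd : ∀ y z, HasFDerivAt (G · z) (G' y z) y) (y : H) :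
    HasFDerivAt (fun y => ∫ z, ψ z • G y z) (∫ z, ψ z • G' y z) y := by
  have hGz : ∀ y, Continuous (G y) := fun y => hG.comp (by fun_prop : Continuous fun z => (y, z))
  have hGz' : ∀ y, Continuous (G' y) :=
    fun y => hG'.comp (by fun_prop : Continuous fun z => (y, z))
  have hcont : Continuous fun p : H × R3 => ψ p.2 • G' p.1 p.2 :=
    (hψ.comp continuous_snd).smul hG'
  obtain ⟨C, hC⟩ := ((isCompact_closedBall y 1).prod hc.isCompact).exists_bound_of_continuousOn
    hcont.continuousOn
  refine hasFDerivAt_integral_of_dominated_of_fderiv_le (s := Metric.closedBall y 1)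
    (bound := (tsupport ψ).indicator fun _ => C)
    (Metric.closedBall_mem_nhds y one_pos)
    (.of_forall fun y => (hψ.smul (hGz y)).aestronglyMeasurable)
    ((hψ.smul (hGz y)).integrable_of_hasCompactSupport hc.smul_right)
    (hψ.smul (hGz' y)).aestronglyMeasurable
    (.of_forall fun z y' hy' => ?_) ?_ (.of_forall fun z y' _ => (hd y' z).const_smul (ψ z))
  · by_cases hz : z ∈ tsupport ψ
    · rw [indicator_of_mem hz]
      exact hC (y', z) ⟨hy', hz⟩
    · simp [indicator_of_notMem hz, image_eq_zero_of_notMem_tsupport hz]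
  · exact (integrable_indicator_iff (isClosed_tsupport ψ).measurableSet).2
      (integrableOn_const hc.isCompact.measure_ne_top)

theorem hasFDerivAt_scaledAverage (hψ : Continuous ψ) (hc : HasCompactSupport ψ)
    (hf : ContDiff ℝ 1 f) (x : R3) (t : ℝ) :
    HasFDerivAt (scaledAverage ψ f · t) (scaledAverage ψ (fderiv ℝ f) x t) x := by
  have hf' : Continuous (fderiv ℝ f) := hf.continuous_fderiv one_ne_zero
  refine hasFDerivAt_integral_weight_smul (G := fun x z => f (x - t • z))
    (G' := fun x z => fderiv ℝ f (x - t • z)) hψ hc ?_ ?_ (fun y z => ?_) x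
  · exact hf.continuous.comp (by fun_prop)
  · exact hf'.comp (by fun_prop)
  · exact ((hf.differentiable one_ne_zero _).hasFDerivAt).comp y
      (f := fun x => x - t • z) ((hasFDerivAt_id y).sub_const _)

end Average

/-! ### Scaled averages of scalar functions: integration by parts and decay. -/

section Scalar

variable {ψ : R3 → ℝ} {f : R3 → ℝ}

theorem fderiv_apply_eq_sum_partialDeriv (x v : R3) :
    fderiv ℝ f x v = ∑ j, v j * partialDeriv j f x := by
  conv_lhs => rw [← (EuclideanSpace.basisFun (Fin 3) ℝ).sum_repr v]
  simp [partialDeriv]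

theorem scaledAverage_fderiv_apply (hψ : Continuous ψ) (hc : HasCompactSupport ψ)
    (hf : ContDiff ℝ 1 f) (x : R3) (t : ℝ) (j : Fin 3) :
    scaledAverage ψ (fderiv ℝ f) x t (EuclideanSpace.single j 1) =
      scaledAverage ψ (partialDeriv j f) x t := by
  unfold scaledAverage
  rw [ContinuousLinearMap.integral_apply
    (integrable_weight_smul hψ hc (hf.continuous_fderiv one_ne_zero) x t)]
  rfl

/-- The chain rule for `f(x - t z)` in `t` produces the factors `-zⱼ`, which are absorbed into the
weight; this is why kernels with gradient `w(z) z` are wanted. -/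
theorem hasDerivAt_scaledAverage (hψ : Continuous ψ) (hc : HasCompactSupport ψ)
    (hf : ContDiff ℝ 1 f) (x : R3) (t : ℝ) :
    HasDerivAt (scaledAverage ψ f x)
      (-∑ j, scaledAverage (fun z => z j * ψ z) (partialDeriv j f) x t) t := by
  have hf' : Continuous (fderiv ℝ f) := hf.continuous_fderiv one_ne_zero
  have hcont : Continuous (Function.uncurry fun (t : ℝ) (z : R3) =>
      fderiv ℝ f (x - t • z) (-z)) :=
    (hf'.comp (by fun_prop : Continuous fun p : ℝ × R3 => x - p.1 • p.2)).clm_apply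
      (by fun_prop)
  have h := hasFDerivAt_integral_weight_smul (H := ℝ) (G := fun t z => f (x - t • z))
    (G' := fun t z => ContinuousLinearMap.toSpanSingleton ℝ (fderiv ℝ f (x - t • z) (-z))) hψ hc
    (hf.continuous.comp (by fun_prop))
    ((ContinuousLinearMap.toSpanSingletonCLE (𝕜 := ℝ) (E := ℝ)).continuous.comp hcont)
    (fun t z => by
      have h1 : HasDerivAt (fun t : ℝ => x - t • z) (-z) t := by
        simpa using ((hasDerivAt_id t).smul_const z).const_sub x
      exact ((hf.differentiable one_ne_zero _).hasFDerivAt.comp_hasDerivAt t h1).hasFDerivAt) t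
  refine h.hasDerivAt.congr_deriv (Eq.symm ?_)
  have hz : Continuous fun z => fderiv ℝ f (x - t • z) (-z) :=
    hcont.comp (by fun_prop : Continuous fun z : R3 => (t, z))
  rw [ContinuousLinearMap.integral_apply]
  · simp only [scaledAverage]
    rw [← integral_finsetSum, ← integral_neg]
    · refine integral_congr_ae (.of_forall fun z => ?_)
      simp only [smul_apply, ContinuousLinearMap.toSpanSingleton_apply,
        fderiv_apply_eq_sum_partialDeriv, smul_eq_mul, one_mul, Finset.mul_sum,
        ← Finset.sum_neg_distrib, PiLp.neg_apply]
      exact Finset.sum_congr rfl fun j _ => by ring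
    · intro j _
      exact integrable_weight_smul (by fun_prop) hc.mul_left (continuous_partialDeriv hf j) x t
  · exact (hψ.smul ((ContinuousLinearMap.toSpanSingletonCLE (𝕜 := ℝ) (E := ℝ)).continuous.comp
      hz)).integrable_of_hasCompactSupport hc.smul_right

/-- Integration by parts in a scaled average. -/
theorem mul_scaledAverage_partialDeriv (hψ : ContDiff ℝ 1 ψ) (hc : HasCompactSupport ψ)
    (hf : ContDiff ℝ 1 f) (x : R3) (t : ℝ) (j : Fin 3) :
    t * scaledAverage ψ (partialDeriv j f) x t = scaledAverage (partialDeriv j ψ) f x t := by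
  have hd : ∀ z, HasFDerivAt (fun z => f (x - t • z)) (-(t • fderiv ℝ f (x - t • z))) z := by
    intro z
    have h1 : HasFDerivAt (fun z : R3 => x - t • z) (-(t • ContinuousLinearMap.id ℝ R3)) z :=
      ((hasFDerivAt_id z).const_smul t).const_sub x
    refine ((hf.differentiable one_ne_zero (x - t • z)).hasFDerivAt.comp z h1).congr_fderiv ?_
    ext v
    simp
  have hfx : ∀ z, fderiv ℝ (fun z => f (x - t • z)) z (EuclideanSpace.single j 1) =
      -(t * partialDeriv j f (x - t • z)) := fun z => by
    rw [(hd z).fderiv]; simp [partialDeriv]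
  have h := integral_mul_fderiv_eq_neg_fderiv_mul_of_integrable (μ := (volume : Measure R3))
    (f := ψ) (g := fun z => f (x - t • z)) (v := EuclideanSpace.single j 1)
    (integrable_weight_smul (continuous_partialDeriv hψ j) (hc.partialDeriv j)
      hf.continuous x t)
    (by
      simp only [hfx]
      have := (integrable_weight_smul hψ.continuous hc (continuous_partialDeriv hf j) x
        t).const_mul (-t)
      refine this.congr (.of_forall fun z => ?_)
      simp; ring)
    (integrable_weight_smul hψ.continuous hc hf.continuous x t)
    (fun z _ => hψ.differentiable one_ne_zero z) (fun z _ => (hd z).differentiableAt)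
  simp only [hfx] at h
  simp only [scaledAverage, smul_eq_mul]
  rw [← integral_const_mul, ← neg_inj]
  refine Eq.trans ?_ h
  rw [← integral_neg]
  exact integral_congr_ae (.of_forall fun z => by simp only; ring)

theorem abs_scaledAverage_le (hψ : Continuous ψ) (hc : HasCompactSupport ψ)
    {K : ℝ} (hK : ∀ x, |f x| ≤ K) (x : R3) (t : ℝ) :
    |scaledAverage ψ f x t| ≤ (∫ z, |ψ z|) * K := by
  unfold scaledAverage
  rw [← integral_mul_const, ← Real.norm_eq_abs]
  refine norm_integral_le_of_norm_le ((hψ.integrable_of_hasCompactSupport hc).abs.mul_const K)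
    (.of_forall fun z => ?_)
  rw [norm_smul]
  exact mul_le_mul_of_nonneg_left (hK _) (norm_nonneg _)

/-- Averages of a square integrable function over dilates decay. -/
theorem exists_abs_scaledAverage_le_div (hψ : Continuous ψ) (hc : HasCompactSupport ψ)
    (hf2 : Integrable fun y => f y ^ 2) :
    ∃ C, ∀ x t, 1 ≤ t → |scaledAverage ψ f x t| ≤ C / t := by
  refine ⟨(∫ z, ψ z ^ 2) + ∫ y, f y ^ 2, fun x t ht => ?_⟩
  have ht0 : 0 < t := one_pos.trans_le ht
  have hψ2 : Integrable fun z => ψ z ^ 2 :=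
    (hψ.pow 2).integrable_of_hasCompactSupport (by
      simpa only [pow_two] using hc.mul_left (f := ψ))
  have hshift : Integrable fun y => f (x - y) ^ 2 := hf2.comp_sub_left x
  have hscale : Integrable fun z => f (x - t • z) ^ 2 :=
    (integrable_comp_smul_iff volume (fun y => f (x - y) ^ 2) ht0.ne').2 hshift
  have hval : ∫ z, f (x - t • z) ^ 2 = (t ^ 3)⁻¹ * ∫ y, f y ^ 2 := by
    rw [Measure.integral_comp_smul volume (fun y => f (x - y) ^ 2) t,
      integral_sub_left_eq_self (fun y => f y ^ 2) volume x]
    simp [abs_of_pos ht0]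
  -- The inequality `ab ≤ a²/t + t b²` is weighted so that the rescaled `L²` norm `t⁻³ ∫ f²` leaves
  -- `t⁻²`, which is at most `t⁻¹`.
  have hle : |scaledAverage ψ f x t| ≤ ∫ z, (t⁻¹ * ψ z ^ 2 + t * f (x - t • z) ^ 2) := by
    unfold scaledAverage
    rw [← Real.norm_eq_abs]
    refine norm_integral_le_of_norm_le ((hψ2.const_mul _).add (hscale.const_mul _))
      (.of_forall fun z => ?_)
    rw [norm_smul, Real.norm_eq_abs, Real.norm_eq_abs, ← sq_abs (ψ z), ← sq_abs (f _)]
    have h1 : t⁻¹ * |ψ z| ^ 2 + t * |f (x - t • z)| ^ 2 - |ψ z| * |f (x - t • z)| =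
      t⁻¹ * ((|ψ z| - t * |f (x - t • z)|) ^ 2 + |ψ z| * (t * |f (x - t • z)|)) := by
      field_simp; ring
    have h2 : 0 ≤ t⁻¹ * ((|ψ z| - t * |f (x - t • z)|) ^ 2 + |ψ z| * (t * |f (x - t • z)|)) := by
      positivity
    linarith
  refine hle.trans ?_
  rw [integral_add (hψ2.const_mul _) (hscale.const_mul _), integral_const_mul,
    integral_const_mul, hval, add_div]
  have h0 : 0 ≤ ∫ y, f y ^ 2 := integral_nonneg fun y => sq_nonneg _
  refine add_le_add (by rw [div_eq_inv_mul]) ?_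
  have : t * ((t ^ 3)⁻¹ * ∫ y, f y ^ 2) = ((∫ y, f y ^ 2) / t) * t⁻¹ := by
    field_simp
  rw [this]
  exact mul_le_of_le_one_right (by positivity) (inv_le_one_of_one_le₀ ht)

/-- Dominated convergence. The null set `z = 0` is excluded because `x - t z` does not escape to
infinity there when `x` is fixed and `t → ∞`. -/
theorem tendsto_scaledAverage_of_tendsto {ι : Type*} {l : Filter ι} [l.IsCountablyGenerated]
    (hψ : Continuous ψ) (hc : HasCompactSupport ψ) (hf : Continuous f)
    {K : ℝ} (hK : ∀ x, |f x| ≤ K) {x : ι → R3} {t : ι → ℝ}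
    (hlim : ∀ z ≠ 0, Tendsto (fun i => f (x i - t i • z)) l (𝓝 0)) :
    Tendsto (fun i => scaledAverage ψ f (x i) (t i)) l (𝓝 0) := by
  have h := tendsto_integral_filter_of_dominated_convergence (μ := (volume : Measure R3)) (l := l)
    (F := fun i z => ψ z • f (x i - t i • z)) (f := fun _ => (0 : ℝ))
    (fun z => |ψ z| * K)
    (.of_forall fun i => (continuous_weight_smul hψ hf _ _).aestronglyMeasurable)
    (.of_forall fun i => .of_forall fun z => by
      rw [norm_smul]
      exact mul_le_mul_of_nonneg_left (hK _) (norm_nonneg _))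
    ((hψ.integrable_of_hasCompactSupport hc).abs.mul_const K)
    (by
      filter_upwards [compl_mem_ae_iff.2 (measure_singleton (0 : R3))] with z hz
      simpa using (hlim z hz).const_mul (ψ z))
  simpa [scaledAverage] using h

theorem isCountablyGenerated_cocompact_R3 : (cocompact R3).IsCountablyGenerated := by
  rw [← Metric.cobounded_eq_cocompact, ← comap_norm_atTop]
  infer_instance

/-- Averages of a function vanishing at infinity over translates vanish at infinity. -/
theorem tendsto_scaledAverage_cocompact (hψ : Continuous ψ) (hc : HasCompactSupport ψ)
    (hf : Continuous f) {K : ℝ} (hK : ∀ x, |f x| ≤ K) (h0 : Tendsto f (cocompact R3) (𝓝 0))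
    (t : ℝ) : Tendsto (scaledAverage ψ f · t) (cocompact R3) (𝓝 0) := by
  have := isCountablyGenerated_cocompact_R3
  refine tendsto_scaledAverage_of_tendsto hψ hc hf hK (x := fun x => x) (t := fun _ => t)
    fun z _ => h0.comp ?_
  exact (Homeomorph.subRight (t • z)).isClosedEmbedding.tendsto_cocompact

theorem tendsto_scaledAverage_atTop (hψ : Continuous ψ) (hc : HasCompactSupport ψ)
    (hf : Continuous f) {K : ℝ} (hK : ∀ x, |f x| ≤ K) (h0 : Tendsto f (cocompact R3) (𝓝 0))
    (x : R3) : Tendsto (scaledAverage ψ f x) atTop (𝓝 0) := by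
  refine tendsto_scaledAverage_of_tendsto hψ hc hf hK (x := fun _ => x) (t := fun t => t)
    fun z hz => h0.comp ?_
  refine (Homeomorph.subLeft x).isClosedEmbedding.tendsto_cocompact.comp ?_
  rw [← Metric.cobounded_eq_cocompact, ← tendsto_norm_atTop_iff_cobounded]
  simp only [norm_smul]
  exact (tendsto_norm_atTop_atTop).atTop_mul_const (norm_pos_iff.2 hz)

end Scalar

/-! ### Radial kernels and the reproducing formula. -/

/-- A smooth compactly supported function with gradient `z ↦ w(z) z`, where the weight `w` is
smooth, compactly supported and has integral one. -/
structure IsRadialKernel (φ w : R3 → ℝ) : Prop where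
  contDiff_kernel : ContDiff ℝ ∞ φ
  hasCompactSupport_kernel : HasCompactSupport φ
  contDiff_weight : ContDiff ℝ ∞ w
  hasCompactSupport_weight : HasCompactSupport w
  partialDeriv_kernel : ∀ j, partialDeriv j φ = fun z => z j * w z
  integral_weight : ∫ z, w z = 1

/-- Functions of `‖z‖²` have gradient `2 P'(‖z‖²) z`, so `P' = W/2` cancels the factor 2. Starting
the primitive at 1, beyond which `W` vanishes, makes `P` vanish there too. -/
theorem exists_isRadialKernel : ∃ φ w : R3 → ℝ, IsRadialKernel φ w := by
  set W : ℝ → ℝ := fun s => Real.smoothTransition (1 - s) with hW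
  have hWc : ContDiff ℝ ∞ W := Real.smoothTransition.contDiff.comp (contDiff_const.sub contDiff_id)
  set P : ℝ → ℝ := fun s => ∫ r in (1 : ℝ)..s, W r / 2 with hP
  have hPd : ∀ s, HasDerivAt P (W s / 2) s := fun s =>
    (hWc.continuous.div_const 2).integral_hasStrictDerivAt 1 s |>.hasDerivAt
  have hPc : ContDiff ℝ ∞ P := by
    rw [contDiff_infty_iff_deriv]
    refine ⟨fun s => (hPd s).differentiableAt, ?_⟩
    rw [show deriv P = fun s => W s / 2 from funext fun s => (hPd s).deriv]
    exact hWc.div_const 2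
  have hW0 : ∀ s, 1 ≤ s → W s = 0 := fun s hs =>
    Real.smoothTransition.zero_of_nonpos (by linarith)
  have hP0 : ∀ s, 1 ≤ s → P s = 0 := by
    intro s hs
    rw [hP]
    refine (intervalIntegral.integral_congr (g := fun _ => (0 : ℝ)) fun r hr => ?_).trans (by simp)
    rw [uIcc_of_le hs] at hr
    simp [hW0 r hr.1]
  have hnorm : ContDiff ℝ ∞ fun z : R3 => ‖z‖ ^ 2 := contDiff_norm_sq ℝ
  have hsupp : ∀ Q : ℝ → ℝ, (∀ s, 1 ≤ s → Q s = 0) →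
      HasCompactSupport fun z : R3 => Q (‖z‖ ^ 2) := by
    intro Q hQ
    refine HasCompactSupport.intro (isCompact_closedBall (0 : R3) 1) fun z hz => hQ _ ?_
    rw [Metric.mem_closedBall, dist_zero_right, not_le] at hz
    nlinarith
  have hWn : ContDiff ℝ ∞ fun z : R3 => W (‖z‖ ^ 2) := hWc.comp hnorm
  set I : ℝ := ∫ z : R3, W (‖z‖ ^ 2) with hI
  have hIpos : 0 < I :=
    hWn.continuous.integral_pos_of_hasCompactSupport_nonneg_nonzero (hsupp W hW0)
      (fun z => Real.smoothTransition.nonneg _) (x := 0) (by simp [hW])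
  refine ⟨fun z => I⁻¹ * P (‖z‖ ^ 2), fun z => I⁻¹ * W (‖z‖ ^ 2),
    contDiff_const.mul (hPc.comp hnorm), (hsupp P hP0).mul_left, contDiff_const.mul hWn,
    (hsupp W hW0).mul_left, fun j => funext fun z => ?_, ?_⟩
  · have h1 : HasFDerivAt (fun z : R3 => ‖z‖ ^ 2) (2 • innerSL ℝ z) z :=
      (hasStrictFDerivAt_norm_sq z).hasFDerivAt
    have h2 := ((hPd (‖z‖ ^ 2)).comp_hasFDerivAt z h1).const_mul I⁻¹
    unfold partialDeriv
    refine (congrArg (fun L : R3 →L[ℝ] ℝ => L (EuclideanSpace.single j 1)) h2.fderiv).trans ?_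
    simp [EuclideanSpace.inner_single_right]
    ring
  · rw [integral_const_mul, inv_mul_cancel₀ hIpos.ne']

namespace IsRadialKernel

variable {φ w : R3 → ℝ}

theorem contDiff_partialDeriv (hk : IsRadialKernel φ w) (i : Fin 3) : ContDiff ℝ ∞ (partialDeriv i φ) :=
  hk.contDiff_kernel.partialDeriv (by simp) i

theorem hasCompactSupport_partialDeriv (hk : IsRadialKernel φ w) (i : Fin 3) : HasCompactSupport (partialDeriv i φ) :=
  hk.hasCompactSupport_kernel.partialDeriv i

theorem hasDerivAt_scaledAverage (hk : IsRadialKernel φ w)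
    {f : R3 → ℝ} (hf : ContDiff ℝ 1 f) (x : R3) (t : ℝ) :
    HasDerivAt (scaledAverage w f x)
      (-∑ j, scaledAverage (partialDeriv j φ) (partialDeriv j f) x t) t := by
  simp only [hk.partialDeriv_kernel]
  exact _root_.hasDerivAt_scaledAverage hk.contDiff_weight.continuous
    hk.hasCompactSupport_weight hf x t

/-- A function is recovered by integrating the averages of its gradient over all scales. -/
theorem integral_sum_scaledAverage (hk : IsRadialKernel φ w)
    {f : R3 → ℝ} (hf : ContDiff ℝ 1 f) (x : R3)
    (h0 : Tendsto (scaledAverage w f x) atTop (𝓝 0))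
    (hint : IntegrableOn
      (fun t => ∑ j, scaledAverage (partialDeriv j φ) (partialDeriv j f) x t) (Ioi 0)) :
    ∫ t in Ioi (0 : ℝ), ∑ j, scaledAverage (partialDeriv j φ) (partialDeriv j f) x t = f x := by
  have h := integral_Ioi_of_hasDerivAt_of_tendsto' (a := 0)
    (fun t _ => hk.hasDerivAt_scaledAverage hf x t) hint.neg h0
  rw [integral_neg, zero_sub, neg_inj] at h
  rw [h]
  -- At scale `t = 0` the average is `f x` times the integral of `w`.
  simp [scaledAverage, integral_mul_const, hk.integral_weight]

end IsRadialKernel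

theorem partialDeriv_comm {ψ : R3 → ℝ} (hψ : ContDiff ℝ 2 ψ) (i j : Fin 3) :
    partialDeriv i (partialDeriv j ψ) = partialDeriv j (partialDeriv i ψ) := by
  have hd : Differentiable ℝ (fderiv ℝ ψ) :=
    (hψ.fderiv_right (m := 1) (by norm_num)).differentiable one_ne_zero
  have key : ∀ i j x, partialDeriv i (partialDeriv j ψ) x =
      fderiv ℝ (fderiv ℝ ψ) x (EuclideanSpace.single i 1) (EuclideanSpace.single j 1) := by
    intro i j x
    unfold partialDeriv
    rw [fderiv_clm_apply (hd x) (differentiableAt_const _)]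
    simp
  funext x
  rw [key, key]
  exact (hψ.contDiffAt.isSymmSndFDerivAt (by simp)).eq _ _

theorem contDiff_one_of_infty {ψ : R3 → ℝ} (hψ : ContDiff ℝ ∞ ψ) : ContDiff ℝ 1 ψ :=
  hψ.of_le (by exact_mod_cast le_top)

/-! ### The potential of a decaying source, scale by scale. -/

/-- A source whose averages decay at large scales and at infinity, so that the gradient of its
Newtonian potential can be computed scale by scale. -/
structure IsDecayingSource (h : R3 → ℝ) : Prop where
  contDiff : ContDiff ℝ 1 h
  exists_bound : ∀ ψ : R3 → ℝ, ContDiff ℝ ∞ ψ → HasCompactSupport ψ →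
    ∃ C, ∀ x t, 0 < t → |scaledAverage ψ h x t| ≤ C * (1 + t ^ 2)⁻¹
  tendsto_zero : ∀ ψ : R3 → ℝ, ContDiff ℝ ∞ ψ → HasCompactSupport ψ →
    ∀ t, 0 < t → Tendsto (scaledAverage ψ h · t) (cocompact R3) (𝓝 0)

namespace IsDecayingSource

variable {h ψ : R3 → ℝ}

theorem continuous_scaledAverage_scale {E : Type*} [NormedAddCommGroup E] [NormedSpace ℝ E]
    {f : R3 → E} (hψ : ContDiff ℝ ∞ ψ) (hc : HasCompactSupport ψ) (hf : Continuous f) (x : R3) :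
    Continuous (scaledAverage ψ f x) :=
  (continuous_scaledAverage hψ.continuous hc hf).comp
    (by fun_prop : Continuous fun t : ℝ => (x, t))

theorem continuous_scaledAverage_center {E : Type*} [NormedAddCommGroup E] [NormedSpace ℝ E]
    {f : R3 → E} (hψ : ContDiff ℝ ∞ ψ) (hc : HasCompactSupport ψ) (hf : Continuous f) (t : ℝ) :
    Continuous (scaledAverage ψ f · t) :=
  (continuous_scaledAverage hψ.continuous hc hf).comp
    (by fun_prop : Continuous fun x : R3 => (x, t))

theorem integrableOn_scaledAverage (hh : IsDecayingSource h) (hψ : ContDiff ℝ ∞ ψ)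
    (hc : HasCompactSupport ψ) (x : R3) : IntegrableOn (scaledAverage ψ h x) (Ioi 0) := by
  obtain ⟨C, hC⟩ := hh.exists_bound ψ hψ hc
  exact (integrable_inv_one_add_sq.const_mul C).integrableOn.mono'
    (continuous_scaledAverage_scale hψ hc hh.contDiff.continuous x).aestronglyMeasurable
    ((ae_restrict_iff' measurableSet_Ioi).2 (.of_forall fun t ht => hC x t ht))

theorem tendsto_integral_scaledAverage (hh : IsDecayingSource h) (hψ : ContDiff ℝ ∞ ψ)
    (hc : HasCompactSupport ψ) :
    Tendsto (fun x => ∫ t in Ioi (0 : ℝ), scaledAverage ψ h x t) (cocompact R3) (𝓝 0) := by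
  have := isCountablyGenerated_cocompact_R3
  obtain ⟨C, hC⟩ := hh.exists_bound ψ hψ hc
  have h := tendsto_integral_filter_of_dominated_convergence (l := cocompact R3)
    (μ := volume.restrict (Ioi (0 : ℝ))) (F := fun x t => scaledAverage ψ h x t)
    (f := fun _ => (0 : ℝ)) (fun t => C * (1 + t ^ 2)⁻¹)
    (.of_forall fun x =>
      (continuous_scaledAverage_scale hψ hc hh.contDiff.continuous x).aestronglyMeasurable)
    (.of_forall fun x => (ae_restrict_iff' measurableSet_Ioi).2
      (.of_forall fun t ht => hC x t ht))
    (integrable_inv_one_add_sq.const_mul C).integrableOn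
    ((ae_restrict_iff' measurableSet_Ioi).2
      (.of_forall fun t ht => hh.tendsto_zero ψ hψ hc t ht))
  simpa using h

/-- For `t ≤ 1` compactness suffices, since `fderiv ℝ h` is continuous; it need not be bounded
globally, so the constant is local in `x`. For `t ≥ 1` the derivative is moved onto `ψ`, at the
harmless cost of a factor `1/t ≤ 1`. -/
theorem exists_bound_fderiv (hh : IsDecayingSource h) (hψ : ContDiff ℝ ∞ ψ)
    (hc : HasCompactSupport ψ) (x₀ : R3) :
    ∃ C, ∀ x ∈ Metric.closedBall x₀ 1, ∀ t, 0 < t →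
      ‖scaledAverage ψ (fderiv ℝ h) x t‖ ≤ C * (1 + t ^ 2)⁻¹ := by
  have hcont := continuous_scaledAverage hψ.continuous hc
    (hh.contDiff.continuous_fderiv one_ne_zero)
  obtain ⟨A, hA⟩ := ((isCompact_closedBall x₀ 1).prod
    (isCompact_Icc (a := (0 : ℝ)) (b := 1))).exists_bound_of_continuousOn hcont.continuousOn
  choose B hB using fun j => hh.exists_bound (partialDeriv j ψ)
    (hψ.partialDeriv (by simp) j) (hc.partialDeriv j)
  have hA0 : 0 ≤ A := (norm_nonneg _).trans
    (hA (x₀, 0) ⟨Metric.mem_closedBall_self zero_le_one, by simp⟩)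
  have hB0 : ∀ j, 0 ≤ B j := fun j => by
    have := (abs_nonneg _).trans (hB j x₀ 1 one_pos)
    norm_num at this
    linarith
  have hS0 : 0 ≤ ∑ j, B j := Finset.sum_nonneg fun j _ => hB0 j
  refine ⟨2 * A + ∑ j, B j, fun x hx t ht => ?_⟩
  rcases le_total t 1 with h1 | h1
  · refine (hA (x, t) ⟨hx, ht.le, h1⟩).trans ?_
    rw [← div_eq_mul_inv, le_div_iff₀ (by positivity)]
    nlinarith [pow_le_one₀ (n := 2) ht.le h1]
  · refine ContinuousLinearMap.opNorm_le_bound _ (by positivity) fun v => ?_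
    have hv : scaledAverage ψ (fderiv ℝ h) x t v =
        ∑ j, v j * scaledAverage ψ (partialDeriv j h) x t := by
      conv_lhs => rw [← (EuclideanSpace.basisFun (Fin 3) ℝ).sum_repr v]
      simp [scaledAverage_fderiv_apply hψ.continuous hc hh.contDiff]
    rw [hv]
    have hj : ∀ j, |scaledAverage ψ (partialDeriv j h) x t| ≤ B j * (1 + t ^ 2)⁻¹ := fun j => by
      refine le_trans ?_ (hB j x t ht)
      rw [← mul_scaledAverage_partialDeriv (contDiff_one_of_infty hψ) hc hh.contDiff, abs_mul,
        abs_of_pos ht]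
      exact le_mul_of_one_le_left (abs_nonneg _) h1
    calc ‖∑ j, v j * scaledAverage ψ (partialDeriv j h) x t‖
        ≤ ∑ j, ‖v‖ * (B j * (1 + t ^ 2)⁻¹) := by
          refine norm_sum_le_of_le _ fun j _ => ?_
          rw [norm_mul]
          exact mul_le_mul (PiLp.norm_apply_le v j) (hj j) (abs_nonneg _) (norm_nonneg _)
      _ = (∑ j, B j) * (1 + t ^ 2)⁻¹ * ‖v‖ := by
          rw [← Finset.mul_sum, ← Finset.sum_mul]; ring
      _ ≤ _ := by gcongr; linarith

theorem integrableOn_scaledAverage_fderiv (hh : IsDecayingSource h) (hψ : ContDiff ℝ ∞ ψ)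
    (hc : HasCompactSupport ψ) (x : R3) :
    IntegrableOn (scaledAverage ψ (fderiv ℝ h) x) (Ioi 0) := by
  obtain ⟨C, hC⟩ := hh.exists_bound_fderiv hψ hc x
  exact (integrable_inv_one_add_sq.const_mul C).integrableOn.mono'
    (continuous_scaledAverage_scale hψ hc
      (hh.contDiff.continuous_fderiv one_ne_zero) x).aestronglyMeasurable
    ((ae_restrict_iff' measurableSet_Ioi).2
      (.of_forall fun t ht => hC x (Metric.mem_closedBall_self zero_le_one) t ht))

theorem hasFDerivAt_integral_scaledAverage (hh : IsDecayingSource h) (hψ : ContDiff ℝ ∞ ψ)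
    (hc : HasCompactSupport ψ) (x : R3) :
    HasFDerivAt (fun x => ∫ t in Ioi (0 : ℝ), scaledAverage ψ h x t)
      (∫ t in Ioi (0 : ℝ), scaledAverage ψ (fderiv ℝ h) x t) x := by
  obtain ⟨C, hC⟩ := hh.exists_bound_fderiv hψ hc x
  exact hasFDerivAt_integral_of_dominated_of_fderiv_le (s := Metric.closedBall x 1)
    (bound := fun t => C * (1 + t ^ 2)⁻¹) (F := fun x t => scaledAverage ψ h x t)
    (F' := fun x t => scaledAverage ψ (fderiv ℝ h) x t)
    (Metric.closedBall_mem_nhds x one_pos)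
    (.of_forall fun x =>
      (continuous_scaledAverage_scale hψ hc hh.contDiff.continuous x).aestronglyMeasurable)
    (hh.integrableOn_scaledAverage hψ hc x)
    (hh.integrableOn_scaledAverage_fderiv hψ hc x).aestronglyMeasurable
    ((ae_restrict_iff' measurableSet_Ioi).2 (.of_forall fun t ht x hx => hC x hx t ht))
    (integrable_inv_one_add_sq.const_mul C).integrableOn
    (.of_forall fun t x _ => hasFDerivAt_scaledAverage hψ.continuous hc hh.contDiff x t)

theorem contDiff_integral_scaledAverage (hh : IsDecayingSource h) (hψ : ContDiff ℝ ∞ ψ)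
    (hc : HasCompactSupport ψ) :
    ContDiff ℝ 1 fun x => ∫ t in Ioi (0 : ℝ), scaledAverage ψ h x t := by
  refine contDiff_one_iff_hasFDerivAt.2
    ⟨_, continuous_iff_continuousAt.2 fun x => ?_, hh.hasFDerivAt_integral_scaledAverage hψ hc⟩
  obtain ⟨C, hC⟩ := hh.exists_bound_fderiv hψ hc x
  refine continuousAt_of_dominated (bound := fun t => C * (1 + t ^ 2)⁻¹)
    (.of_forall fun x => (hh.integrableOn_scaledAverage_fderiv hψ hc x).aestronglyMeasurable)
    ?_ (integrable_inv_one_add_sq.const_mul C).integrableOn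
    (.of_forall fun t => (continuous_scaledAverage_center hψ hc
      (hh.contDiff.continuous_fderiv one_ne_zero) t).continuousAt)
  filter_upwards [Metric.closedBall_mem_nhds x one_pos] with y hy
  exact (ae_restrict_iff' measurableSet_Ioi).2 (.of_forall fun t ht => hC y hy t ht)

theorem integrableOn_scaledAverage_partialDeriv (hh : IsDecayingSource h) (hψ : ContDiff ℝ ∞ ψ)
    (hc : HasCompactSupport ψ) (x : R3) (j : Fin 3) :
    IntegrableOn (scaledAverage ψ (partialDeriv j h) x) (Ioi 0) := by
  have := (hh.integrableOn_scaledAverage_fderiv hψ hc x).apply_continuousLinearMap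
    (EuclideanSpace.single j 1)
  simp only [scaledAverage_fderiv_apply hψ.continuous hc hh.contDiff] at this
  exact this

theorem partialDeriv_integral_scaledAverage (hh : IsDecayingSource h) (hψ : ContDiff ℝ ∞ ψ)
    (hc : HasCompactSupport ψ) (x : R3) (j : Fin 3) :
    partialDeriv j (fun x => ∫ t in Ioi (0 : ℝ), scaledAverage ψ h x t) x =
      ∫ t in Ioi (0 : ℝ), scaledAverage ψ (partialDeriv j h) x t := by
  unfold partialDeriv
  rw [(hh.hasFDerivAt_integral_scaledAverage hψ hc x).fderiv, ContinuousLinearMap.integral_apply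
    (hh.integrableOn_scaledAverage_fderiv hψ hc x)]
  simp only [scaledAverage_fderiv_apply hψ.continuous hc hh.contDiff]
  rfl

theorem tendsto_scaledAverage_atTop (hh : IsDecayingSource h) (hψ : ContDiff ℝ ∞ ψ)
    (hc : HasCompactSupport ψ) (x : R3) : Tendsto (scaledAverage ψ h x) atTop (𝓝 0) := by
  obtain ⟨C, hC⟩ := hh.exists_bound ψ hψ hc
  refine squeeze_zero_norm' (a := fun t => C * (1 + t ^ 2)⁻¹)
    (eventually_atTop.2 ⟨1, fun t ht => hC x t (one_pos.trans_le ht)⟩) ?_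
  have h1 : Tendsto (fun t : ℝ => 1 + t ^ 2) atTop atTop :=
    tendsto_atTop_add_const_left _ _ (tendsto_pow_atTop two_ne_zero)
  simpa using h1.inv_tendsto_atTop.const_mul C

variable {φ w : R3 → ℝ}

/-- The mixed second derivatives of the potential agree. -/
theorem partialDeriv_integral_comm (hh : IsDecayingSource h) (hk : IsRadialKernel φ w) (x : R3)
    (i j : Fin 3) :
    partialDeriv i (fun x => ∫ t in Ioi (0 : ℝ), scaledAverage (partialDeriv j φ) h x t) x =
      partialDeriv j (fun x => ∫ t in Ioi (0 : ℝ), scaledAverage (partialDeriv i φ) h x t) x := by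
  rw [hh.partialDeriv_integral_scaledAverage (hk.contDiff_partialDeriv j)
      (hk.hasCompactSupport_partialDeriv j),
    hh.partialDeriv_integral_scaledAverage (hk.contDiff_partialDeriv i)
      (hk.hasCompactSupport_partialDeriv i)]
  -- Multiplying by `t` moves the remaining derivative onto the weight, so both sides become
  -- averages of `h` against a mixed second derivative of `φ`.
  refine setIntegral_congr_fun measurableSet_Ioi fun t ht => mul_left_cancel₀ (ne_of_gt ht) ?_
  rw [mul_scaledAverage_partialDeriv (contDiff_one_of_infty (hk.contDiff_partialDeriv j))
      (hk.hasCompactSupport_partialDeriv j) hh.contDiff,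
    mul_scaledAverage_partialDeriv (contDiff_one_of_infty (hk.contDiff_partialDeriv i))
      (hk.hasCompactSupport_partialDeriv i) hh.contDiff,
    partialDeriv_comm (contDiff_infty.1 hk.contDiff_kernel 2)]

/-- Poisson's equation for the potential of a decaying source. -/
theorem sum_partialDeriv_integral (hh : IsDecayingSource h) (hk : IsRadialKernel φ w) (x : R3) :
    ∑ i, partialDeriv i
      (fun x => ∫ t in Ioi (0 : ℝ), scaledAverage (partialDeriv i φ) h x t) x = h x := by
  have hint := fun i => hh.integrableOn_scaledAverage_partialDeriv (hk.contDiff_partialDeriv i)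
    (hk.hasCompactSupport_partialDeriv i) x i
  simp only [fun i => hh.partialDeriv_integral_scaledAverage (hk.contDiff_partialDeriv i)
    (hk.hasCompactSupport_partialDeriv i) x i]
  rw [← integral_finsetSum _ fun i _ => hint i]
  exact hk.integral_sum_scaledAverage hh.contDiff x
    (hh.tendsto_scaledAverage_atTop hk.contDiff_weight hk.hasCompactSupport_weight x)
    (integrable_finsetSum _ fun i _ => hint i)

end IsDecayingSource

/-! ### Vector fields in components, and vanishing of irrotational solenoidal fields. -/

theorem pderiv_eq_partialDeriv {F : R3 → R3} (hF : ContDiff ℝ 1 F) (i j : Fin 3) (x : R3) :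
    pderiv F i j x = partialDeriv i (fun y => F y j) x := by
  have h := (EuclideanSpace.proj (𝕜 := ℝ) j).hasFDerivAt.comp x
    (hF.differentiable one_ne_zero x).hasFDerivAt
  unfold pderiv partialDeriv
  refine Eq.trans ?_ (congrArg (fun L : R3 →L[ℝ] ℝ => L (EuclideanSpace.single i 1))
    h.fderiv).symm
  rfl

theorem curl_eq_zero_iff {F : R3 → R3} (x : R3) :
    curl F x = 0 ↔ ∀ i j, pderiv F i j x = pderiv F j i x := by
  constructor
  · intro h
    have h0 := congrArg (fun v : R3 => v 0) h
    have h1 := congrArg (fun v : R3 => v 1) h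
    have h2 := congrArg (fun v : R3 => v 2) h
    simp [curl, sub_eq_zero] at h0 h1 h2
    intro i j
    fin_cases i <;> fin_cases j <;> simp [h0, h1, h2]
  · intro h
    ext i
    fin_cases i <;> simp [curl, h]

theorem ContDiff.component {n : WithTop ℕ∞} {F : R3 → R3} (hF : ContDiff ℝ n F) (j : Fin 3) :
    ContDiff ℝ n fun x => F x j :=
  contDiff_euclidean.1 hF j

theorem VanishesAtInfinity.component {F : R3 → R3} (hF : VanishesAtInfinity F) (j : Fin 3) :
    Tendsto (fun x => F x j) (cocompact R3) (𝓝 0) :=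
  ((EuclideanSpace.proj (𝕜 := ℝ) j).continuous.tendsto' (0 : R3) 0 rfl).comp hF

theorem exists_abs_le_of_tendsto_cocompact {f : R3 → ℝ} (hf : Continuous f)
    (h0 : Tendsto f (cocompact R3) (𝓝 0)) : ∃ K, ∀ x, |f x| ≤ K := by
  obtain ⟨s, hs, hs1⟩ := mem_cocompact.1 (h0.norm.eventually_le_const
    (by simp : ‖(0 : ℝ)‖ < 1))
  obtain ⟨K, hK⟩ := hs.exists_bound_of_continuousOn hf.continuousOn
  refine ⟨max K 1, fun x => ?_⟩
  by_cases hx : x ∈ s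
  · exact (hK x hx).trans (le_max_left _ _)
  · exact (hs1 hx : ‖f x‖ ≤ 1).trans (le_max_right _ _)

theorem divergence_sub {F G : R3 → R3} (hF : Differentiable ℝ F) (hG : Differentiable ℝ G)
    (x : R3) : divergence (fun y => F y - G y) x = divergence F x - divergence G x := by
  simp [divergence, pderiv, fderiv_fun_sub (hF x) (hG x), Finset.sum_sub_distrib]

/-- An irrotational and solenoidal field that vanishes at infinity is zero. -/
theorem eq_zero_of_curl_divergence_eq_zero {D : R3 → R3} (hD : ContDiff ℝ 1 D)
    (h0 : VanishesAtInfinity D) (hcurl : ∀ x, curl D x = 0) (hdiv : ∀ x, divergence D x = 0)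
    (x : R3) : D x = 0 := by
  obtain ⟨φ, w, hk⟩ := exists_isRadialKernel
  ext i
  obtain ⟨K, hK⟩ := exists_abs_le_of_tendsto_cocompact (hD.component i).continuous (h0.component i)
  have hsymm : ∀ j, partialDeriv j (fun y => D y i) = partialDeriv i fun y => D y j := by
    intro j
    funext y
    rw [← pderiv_eq_partialDeriv hD, ← pderiv_eq_partialDeriv hD]
    exact (curl_eq_zero_iff y).1 (hcurl y) j i
  -- Irrotationality turns `∂ⱼDᵢ` into `∂ᵢDⱼ`; two integrations by parts then exchange `i` and `j`
  -- between weight and field, leaving the average of `∇·D` against `∂ᵢφ`.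
  have hsum : ∀ t ∈ Ioi (0 : ℝ),
      ∑ j, scaledAverage (partialDeriv j φ) (partialDeriv j fun y => D y i) x t = 0 := by
    intro t ht
    refine mul_left_cancel₀ (ne_of_gt ht) ?_
    have hswap : ∀ j, t * scaledAverage (partialDeriv j φ) (partialDeriv j fun y => D y i) x t =
        t * scaledAverage (partialDeriv i φ) (partialDeriv j fun y => D y j) x t := by
      intro j
      rw [hsymm, mul_scaledAverage_partialDeriv
          (contDiff_one_of_infty (hk.contDiff_partialDeriv j))
          (hk.hasCompactSupport_partialDeriv j) (hD.component j),
        mul_scaledAverage_partialDeriv (contDiff_one_of_infty (hk.contDiff_partialDeriv i))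
          (hk.hasCompactSupport_partialDeriv i) (hD.component j),
        partialDeriv_comm (contDiff_infty.1 hk.contDiff_kernel 2)]
    rw [Finset.mul_sum, Finset.sum_congr rfl fun j _ => hswap j, ← Finset.mul_sum]
    congr 1
    unfold scaledAverage
    rw [← integral_finsetSum _ fun j _ => integrable_weight_smul
      (hk.contDiff_partialDeriv i).continuous (hk.hasCompactSupport_partialDeriv i)
      (continuous_partialDeriv (hD.component j) j) x t]
    simp only [← Finset.smul_sum, ← pderiv_eq_partialDeriv hD]
    simp only [divergence] at hdiv
    simp [hdiv]
  have h := hk.integral_sum_scaledAverage (hD.component i) x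
    (tendsto_scaledAverage_atTop hk.contDiff_weight.continuous hk.hasCompactSupport_weight
      (hD.component i).continuous hK (h0.component i) x)
    (integrableOn_zero.congr_fun (fun t ht => (hsum t ht).symm) measurableSet_Ioi)
  rw [← h, setIntegral_congr_fun measurableSet_Ioi hsum]
  simp

/-! ### Decay estimates for the source `∇·F`. -/

/-- The divergence of a decaying field with bounded derivative is a decaying source. -/
theorem isDecayingSource_divergence {F : R3 → R3} (hF : ContDiff ℝ 2 F)
    (hderiv : ∃ K : ℝ, ∀ x, ‖fderiv ℝ F x‖ ≤ K) (h0 : VanishesAtInfinity F)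
    (h2 : ∀ j, Integrable fun x => F x j ^ 2) : IsDecayingSource (divergence F) := by
  have hF1 : ContDiff ℝ 1 F := hF.of_le one_le_two
  have hdiv : divergence F = fun x => ∑ j, partialDeriv j (fun y => F y j) x := by
    funext x
    simp only [divergence, pderiv_eq_partialDeriv hF1]
  have hpc : ∀ j, ContDiff ℝ 1 (partialDeriv j fun y => F y j) := fun j =>
    (hF.component j).partialDeriv (by norm_num) j
  have hcd : ContDiff ℝ 1 (divergence F) := by
    rw [hdiv]
    exact ContDiff.sum fun j _ => hpc j
  obtain ⟨K, hK⟩ := hderiv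
  have hbd : ∀ x, |divergence F x| ≤ 3 * K := by
    intro x
    refine (Finset.abs_sum_le_sum_abs _ _).trans
      ((Finset.sum_le_sum fun j _ => ?_).trans_eq (by simp : ∑ _j : Fin 3, K = 3 * K))
    have h := (PiLp.norm_apply_le (fderiv ℝ F x (EuclideanSpace.single j 1)) j).trans
      ((fderiv ℝ F x).le_opNorm _)
    rw [PiLp.norm_single, norm_one, mul_one] at h
    exact h.trans (hK x)
  have hparts : ∀ ψ : R3 → ℝ, ContDiff ℝ ∞ ψ → HasCompactSupport ψ → ∀ x t,
      t * scaledAverage ψ (divergence F) x t =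
        ∑ j, scaledAverage (partialDeriv j ψ) (fun y => F y j) x t := by
    intro ψ hψ hc x t
    simp only [← mul_scaledAverage_partialDeriv (contDiff_one_of_infty hψ) hc
      (hF1.component _), ← Finset.mul_sum]
    congr 1
    unfold scaledAverage
    rw [← integral_finsetSum _ fun j _ => integrable_weight_smul hψ.continuous hc
      (hpc j).continuous x t]
    simp only [hdiv, Finset.smul_sum]
  refine ⟨hcd, fun ψ hψ hc => ?_, fun ψ hψ hc t ht => ?_⟩
  · choose B hB using fun j => exists_abs_scaledAverage_le_div
      (hψ.partialDeriv (by simp) j : ContDiff ℝ ∞ (partialDeriv j ψ)).continuous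
      (hc.partialDeriv j) (h2 j)
    have hA := abs_scaledAverage_le hψ.continuous hc hbd
    set A : ℝ := (∫ z, |ψ z|) * (3 * K)
    have hA0 : 0 ≤ A := (abs_nonneg _).trans (hA 0 0)
    have hB0 : ∀ j, 0 ≤ B j := fun j => by
      have := (abs_nonneg _).trans (hB j 0 1 le_rfl)
      simpa using this
    have hS0 : 0 ≤ ∑ j, B j := Finset.sum_nonneg fun j _ => hB0 j
    -- The factor 2 bounds `1 + t²` by 2 when `t ≤ 1` and by `2t²` when `t ≥ 1`.
    refine ⟨2 * (A + ∑ j, B j), fun x t ht => ?_⟩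
    rw [← div_eq_mul_inv, le_div_iff₀ (by positivity)]
    rcases le_total t 1 with h1 | h1
    · have ht2 : t ^ 2 ≤ 1 := pow_le_one₀ ht.le h1
      calc |scaledAverage ψ (divergence F) x t| * (1 + t ^ 2) ≤ A * 2 :=
            mul_le_mul (hA x t) (by linarith) (by positivity) hA0
        _ ≤ _ := by linarith
    · have ht2 : 1 ≤ t ^ 2 := one_le_pow₀ h1
      have hle : t * |scaledAverage ψ (divergence F) x t| ≤ (∑ j, B j) / t := by
        rw [← abs_of_pos ht, ← abs_mul, abs_of_pos ht, hparts ψ hψ hc x t, Finset.sum_div]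
        exact (Finset.abs_sum_le_sum_abs _ _).trans (Finset.sum_le_sum fun j _ => hB j x t h1)
      rw [le_div_iff₀ ht] at hle
      have := abs_nonneg (scaledAverage ψ (divergence F) x t)
      nlinarith
  -- Only `F`, not its divergence, is known to vanish at infinity, so the limit is taken after
  -- integrating by parts at fixed `t > 0`.
  · have hlim : ∀ j, Tendsto (fun x => scaledAverage (partialDeriv j ψ) (fun y => F y j) x t)
        (cocompact R3) (𝓝 0) := fun j => by
      obtain ⟨M, hM⟩ := exists_abs_le_of_tendsto_cocompact (hF1.component j).continuous
        (h0.component j)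
      exact tendsto_scaledAverage_cocompact
        (hψ.partialDeriv (by simp) j : ContDiff ℝ ∞ (partialDeriv j ψ)).continuous
        (hc.partialDeriv j) (hF1.component j).continuous hM (h0.component j) t
    have hs := (tendsto_finsetSum Finset.univ fun j _ => hlim j).const_mul t⁻¹
    simp only [← hparts ψ hψ hc, inv_mul_cancel_left₀ ht.ne', Finset.sum_const_zero,
      mul_zero] at hs
    exact hs

section Decay

variable {F : R3 → R3} {ε C : ℝ}

theorem vanishesAtInfinity_of_decay (hε : 0 < ε)
    (hF : ∀ x, ‖F x‖ ≤ C * (1 + ‖x‖) ^ (-(2 + ε))) : VanishesAtInfinity F := by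
  refine squeeze_zero_norm hF ?_
  have h1 : Tendsto (fun x : R3 => 1 + ‖x‖) (cocompact R3) atTop :=
    tendsto_atTop_add_const_left _ _ (tendsto_norm_cocompact_atTop)
  simpa using ((tendsto_rpow_neg_atTop (by linarith : 0 < 2 + ε)).comp h1).const_mul C

/-- The squared majorant has exponent `2(2 + ε)`, which exceeds the dimension 3. -/
theorem integrable_sq_of_decay (hε : 0 < ε) (hc : Continuous F)
    (hF : ∀ x, ‖F x‖ ≤ C * (1 + ‖x‖) ^ (-(2 + ε))) (j : Fin 3) :
    Integrable fun x => F x j ^ 2 := by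
  have hint : Integrable fun x : R3 => C ^ 2 * (1 + ‖x‖) ^ (-(2 * (2 + ε))) :=
    (integrable_one_add_norm (μ := (volume : Measure R3)) (r := 2 * (2 + ε))
      (by simp; linarith)).const_mul _
  refine hint.mono' (by fun_prop) (.of_forall fun x => ?_)
  rw [norm_pow]
  calc ‖F x j‖ ^ 2 ≤ (C * (1 + ‖x‖) ^ (-(2 + ε))) ^ 2 :=
        pow_le_pow_left₀ (norm_nonneg _) ((PiLp.norm_apply_le _ _).trans (hF x)) 2
    _ = _ := by
        rw [mul_pow, ← Real.rpow_mul_natCast (by positivity)]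
        congr 2
        push_cast
        ring

end Decay

/-! ### Existence and uniqueness of the decomposition. -/

theorem exists_isHelmholtzDecomposition {F : R3 → R3} (hF : ContDiff ℝ 2 F)
    (h0 : VanishesAtInfinity F) (hs : IsDecayingSource (divergence F)) :
    ∃ Fc Fs, IsHelmholtzDecomposition F Fc Fs := by
  obtain ⟨φ, w, hk⟩ := exists_isRadialKernel
  have hF1 : ContDiff ℝ 1 F := hF.of_le one_le_two
  set G : R3 → R3 := fun x => WithLp.toLp 2 fun i =>
    ∫ t in Ioi (0 : ℝ), scaledAverage (partialDeriv i φ) (divergence F) x t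
  have hG : ContDiff ℝ 1 G := contDiff_euclidean.2 fun i =>
    hs.contDiff_integral_scaledAverage (hk.contDiff_partialDeriv i)
      (hk.hasCompactSupport_partialDeriv i)
  have hG0 : VanishesAtInfinity G :=
    ((PiLp.continuous_toLp 2 fun _ : Fin 3 => ℝ).tendsto' 0 0 rfl).comp
      (tendsto_pi_nhds.2 fun i => hs.tendsto_integral_scaledAverage (hk.contDiff_partialDeriv i)
        (hk.hasCompactSupport_partialDeriv i))
  refine ⟨G, fun x => F x - G x, hG, hF1.sub hG, hG0, ?_, fun x => ?_, fun x => ?_, fun x => ?_⟩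
  · have := Tendsto.sub h0 hG0
    rwa [sub_zero] at this
  · refine (curl_eq_zero_iff x).2 fun i j => ?_
    rw [pderiv_eq_partialDeriv hG, pderiv_eq_partialDeriv hG]
    exact hs.partialDeriv_integral_comm hk x i j
  · rw [divergence_sub (hF1.differentiable one_ne_zero) (hG.differentiable one_ne_zero),
      sub_eq_zero, ← hs.sum_partialDeriv_integral hk x]
    simp only [divergence, pderiv_eq_partialDeriv hG]
    rfl
  · simp

theorem IsHelmholtzDecomposition.unique {F Fc Fs Gc Gs : R3 → R3}
    (hF : IsHelmholtzDecomposition F Fc Fs) (hG : IsHelmholtzDecomposition F Gc Gs) :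
    Fc = Gc ∧ Fs = Gs := by
  have hc1 := hF.contDiff_conservative.differentiable one_ne_zero
  have hc2 := hG.contDiff_conservative.differentiable one_ne_zero
  -- The one difference is irrotational in its first form and solenoidal in its second.
  have hD : (fun x => Fc x - Gc x) = fun x => Gs x - Fs x := by
    funext x
    rw [sub_eq_sub_iff_add_eq_add, ← hF.sum_eq, add_comm, ← hG.sum_eq]
  have hcd := hF.contDiff_conservative.sub hG.contDiff_conservative
  have hz := eq_zero_of_curl_divergence_eq_zero hcd
    (by simpa [VanishesAtInfinity] using Tendsto.sub hF.vanishes_conservative hG.vanishes_conservative)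
    (fun x => (curl_eq_zero_iff x).2 fun i j => by
      have h1 := (curl_eq_zero_iff x).1 (hF.irrotational x) i j
      have h2 := (curl_eq_zero_iff x).1 (hG.irrotational x) i j
      unfold pderiv at h1 h2 ⊢
      simp only [fderiv_fun_sub (hc1 x) (hc2 x), sub_apply, PiLp.sub_apply, h1, h2])
    (fun x => by
      rw [hD, divergence_sub (hG.contDiff_solenoidal.differentiable one_ne_zero)
        (hF.contDiff_solenoidal.differentiable one_ne_zero), hG.divergence_free,
        hF.divergence_free, sub_zero])
  exact ⟨funext fun x => sub_eq_zero.1 (hz x),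
    funext fun x => (sub_eq_zero.1 ((congrFun hD x).symm.trans (hz x))).symm⟩

theorem mainTheorem1 (F : R3 → R3)
    (hsmooth : ContDiff ℝ 2 F)
    (hderiv : ∃ K : ℝ, ∀ x, ‖fderiv ℝ F x‖ ≤ K)
    (hdecay : ∃ ε : ℝ, 0 < ε ∧ ∃ C : ℝ, ∀ x, ‖F x‖ ≤ C * (1 + ‖x‖) ^ (-(2 + ε))) :
    ∃! P : (R3 → R3) × (R3 → R3), IsHelmholtzDecomposition F P.1 P.2 := by
  obtain ⟨ε, hε, C, hC⟩ := hdecay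
  have h0 := vanishesAtInfinity_of_decay hε hC
  obtain ⟨Fc, Fs, h⟩ := exists_isHelmholtzDecomposition hsmooth h0
    (isDecayingSource_divergence hsmooth hderiv h0
      (integrable_sq_of_decay hε hsmooth.continuous hC))
  refine ⟨(Fc, Fs), h, fun P hP => ?_⟩
  obtain ⟨hc, hs⟩ := hP.unique h
  exact Prod.ext hc hs
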